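/- **Definitions.** For $n,k\in\mathbb N$ and $\Omega\subseteq\mathbb R$ let $$\mathcal M_k^n(\Omega)=\{C_1C_2\cdots C_k \;:\; C_i=I-\beta_i v_iv_i^\top\in\mathbb R^{n\times n},\ 1-\beta_i\in\Omega,\ v_i\in\mathbb R^n,\ \|v_i\|_2=1\}$$ be the set of products of $k$ generalized Householder matrices. A layer of a linear recurrent neural network (LRNN) with input dimension $l$, state dimensions $n\times d$ and output dimension $p$ consists of $H_0\in\mathbb C^{n\times d}$ and arbitrary functions $A:\mathbb R^l\to\mathbb C^{n\times n}$, $B:\mathbb R^l\to\mathbb C^{n\times d}$, $\mathrm{dec}:\mathbb C^{n\times d}\times\mathbb R^l\to\mathbb R^p$. It maps an input sequence $x_1,\dots,x_t\in\mathbb R^l$ to the output sequence $y_1,\dots,y_t\in\mathbb R^p$ given by $$H_i=A(x_i)H_{i-1}+B(x_i),\qquad y_i=\mathrm{dec}(H_i,x_i).$$ An LRNN with $s\ge 1$ layers is a stack of $s$ such layers, the outputs of each layer being the inputs of the next one; its state is the tuple of the states of all layers, and its output is the output of the last layer. The dimensions $n$ and $p$ may differ from layer to layer. Let $\Sigma$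 be a finite alphabet whose letters are fed to the first layer through a given injective map $\Sigma\to\mathbb R^l$ (for instance the inclusion, if $\Sigma\subset\mathbb N$ and $l=1$). The LRNN has *finite precision* if there is one finite set $\mathbb D\subset\mathbb R$ that contains all numbers occurring in its computations on all words over $\Sigma$, independently of their length (entries of all layer inputs and outputs, of $A(x_i)$, $B(x_i)$, $H_i$, and all products and partial sums in $A(x_i)H_{i-1}$). A finite state automaton (FSA) is a tuple $\mathcal A=(\Sigma,Q,q_0,\delta)$ with finite $Q$, $q_0\in Q$ and $\delta:Q\times\Sigma\to Q$; write $\delta(q_0,w)$ for the state reached after reading $w\in\Sigma^*$. The LRNN *implements* $\mathcal A$ if there is a map $g$ from the set of LRNN states reachable from the initial one onto the set $\{\delta(q_0,w):w\in\Sigma^*\}$ of reachable states of $\mathcal A$ (which is all of $Q$ if every state is reachable) that sends the initial state to $q_0$ and satisfies $\delta(g(H),a)=g(H')$ whenever the LRNN passes from the reachable state $H$ to $H'$ on reading $a\in\Sigma$. The LRNN *recognizes* a language $L\subseteq\Sigma^*$ if its output dimension is $1$, for every nonempty word $w$ its last output on $w$ is $1$ if $w\in L$ and $0$ if $w\notin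 L$, and for every word $w$, including the empty one, the state reached on $w$ determines whether $w\in L$. **Theorem.** Let $\mathcal A=(\Sigma,Q,q_0,\delta)$ be an FSA. 1. $\mathcal A$ can be implemented by a finite precision LRNN with $1\le s\le 2^{|Q|}$ layers, in each of which $1\le n\le|Q|$, $1\le p\le s$, $d=1$, $A:\mathbb R^l\to\mathcal M_n^n([-1,1])$ and $B:\mathbb R^l\to\mathbb N^n$ (here $l$ is the input dimension of the layer). Moreover the state $\delta(q_0,w)$ is a function of the last output of the LRNN on $w$, for every nonempty word $w$. 2. For every $R\subseteq Q$, the language $\{w\in\Sigma^*:\delta(q_0,w)\in R\}$ is recognized by a finite precision LRNN that satisfies the same bounds and conditions as in 1. Consequently every regular language over $\Sigma$ is recognized by a finite precision LRNN with state-transition matrices in $\mathcal M_n^n([-1,1])$ of this form. -/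

import Mathlib

/-- A deterministic finite state automaton `(Σ, Q, q₀, δ)` without accepting states
(`Σ = α`; finiteness of `α` and `Q` is imposed where the automaton is used). -/
structure FSA (α : Type*) (Q : Type*) where
  /-- the starting state `q₀` -/
  start : Q
  /-- the state-transition function `δ` -/
  δ : Q → α → Q

/-- The state `δ(q₀, w)` reached after reading the word `w`. -/
def FSA.eval {α Q : Type*} (𝒜 : FSA α Q) (w : List α) : Q :=
  w.foldl 𝒜.δ 𝒜.start

/-- The set of states that are reachable from the starting state. -/
def FSA.reachable {α Q : Type*} (𝒜 : FSA α Q) : Set Q :=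
  Set.range 𝒜.eval

/-- The language recognized by the automaton with recognizing set `R`. -/
def FSA.language {α Q : Type*} (𝒜 : FSA α Q) (R : Set Q) : Language α :=
  {w | 𝒜.eval w ∈ R}

/-- The generalized Householder matrix `I - β v vᵀ`. -/
def ghMatrix {n : ℕ} (β : ℝ) (v : EuclideanSpace ℝ (Fin n)) : Matrix (Fin n) (Fin n) ℝ :=
  1 - β • Matrix.vecMulVec (WithLp.ofLp v) (WithLp.ofLp v)

/-- The set `ℳ_k^n(Ω)` of all products `C₁ C₂ ⋯ C_k` of `k` generalized Householder matrices
`C_i = I - β_i v_i v_iᵀ` with `1 - β_i ∈ Ω` and `‖v_i‖ = 1` (Euclidean norm). -/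
def ghProducts (n k : ℕ) (Ω : Set ℝ) : Set (Matrix (Fin n) (Fin n) ℝ) :=
  {M | ∃ (β : Fin k → ℝ) (v : Fin k → EuclideanSpace ℝ (Fin n)),
    (∀ i, 1 - β i ∈ Ω) ∧ (∀ i, ‖v i‖ = 1) ∧
    M = (List.ofFn fun i => ghMatrix (β i) (v i)).prod}

/-- One layer of a linear recurrent neural network, with inputs in `ℝ^l`, states in
`ℂ^{n × d}` and outputs in `ℝ^p`:
`H_i = A(x_i) H_{i-1} + B(x_i)`, `y_i = dec(H_i, x_i)`. -/
structure LRNNLayer (l n d p : ℕ) where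
  /-- the initial state `H₀` -/
  H₀ : Matrix (Fin n) (Fin d) ℂ
  /-- the state-transition matrix as a function of the input -/
  A : (Fin l → ℝ) → Matrix (Fin n) (Fin n) ℂ
  /-- the additive term as a function of the input -/
  B : (Fin l → ℝ) → Matrix (Fin n) (Fin d) ℂ
  /-- the decoder -/
  dec : Matrix (Fin n) (Fin d) ℂ → (Fin l → ℝ) → Fin p → ℝ

namespace LRNNLayer

variable {l n d p : ℕ}

/-- The state update `A(x) H + B(x)`. -/
def next (L : LRNNLayer l n d p) (H : Matrix (Fin n) (Fin d) ℂ) (x : Fin l → ℝ) :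
    Matrix (Fin n) (Fin d) ℂ :=
  L.A x * H + L.B x

/-- `A : ℝ^l → ℳ_n^n([-1,1])`. -/
def HasGHTransitions (L : LRNNLayer l n d p) : Prop :=
  ∀ x, ∃ M ∈ ghProducts n n (Set.Icc (-1) 1), L.A x = M.map (fun r : ℝ => (r : ℂ))

/-- All entries of all values of `B` are natural numbers. -/
def HasNatInputs (L : LRNNLayer l n d p) : Prop :=
  ∀ x i j, ∃ m : ℕ, L.B x i j = (m : ℂ)

/-- All numbers that occur when the layer, being in state `H`, reads `x`, belong to `D ⊆ ℝ`: the
entries of the input, of `A(x)`, `B(x)`, of the old and the new state and of the output, and, for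
every order in which the products `A(x) H` may be summed up, all partial sums (singletons `T` give
the individual products, `T = univ` gives the entries of `A(x) H`). -/
def ComputesIn (D : Set ℝ) (L : LRNNLayer l n d p) (H : Matrix (Fin n) (Fin d) ℂ)
    (x : Fin l → ℝ) : Prop :=
  (∀ i, x i ∈ D) ∧
  (∀ i j, ∃ r ∈ D, L.A x i j = ((r : ℝ) : ℂ)) ∧
  (∀ i j, ∃ r ∈ D, L.B x i j = ((r : ℝ) : ℂ)) ∧
  (∀ i j, ∃ r ∈ D, H i j = ((r : ℝ) : ℂ)) ∧
  (∀ i j, ∀ T : Finset (Fin n), ∃ r ∈ D, ∑ k ∈ T, L.A x i k * H k j = ((r : ℝ) : ℂ)) ∧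
  (∀ i j, ∃ r ∈ D, L.next H x i j = ((r : ℝ) : ℂ)) ∧
  (∀ i, L.dec (L.next H x) x i ∈ D)

end LRNNLayer

/-- A linear recurrent neural network with inputs in `ℝ^l` and outputs in `ℝ^p`: a nonempty
finite stack of layers (first layer on the left) with state width `d`; the outputs of each layer
are the inputs of the next one. The other dimensions may vary from layer to layer. -/
inductive LRNN (d : ℕ) : ℕ → ℕ → Type
  | single {l n p : ℕ} (L : LRNNLayer l n d p) : LRNN d l p
  | cons {l n k p : ℕ} (L : LRNNLayer l n d k) (N : LRNN d k p) : LRNN d l p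

namespace LRNN

variable {d : ℕ}

/-- The number of layers. -/
def depth : {l p : ℕ} → LRNN d l p → ℕ
  | _, _, single _ => 1
  | _, _, cons _ N => N.depth + 1

/-- `P l n p L` holds for every layer `L` of the network, where `l`, `n`, `p` are its input
dimension, state dimension and output dimension. -/
def ForallLayers (P : (l n p : ℕ) → LRNNLayer l n d p → Prop) : {l p : ℕ} → LRNN d l p → Prop
  | _, _, single L => P _ _ _ L
  | _, _, cons L N => P _ _ _ L ∧ N.ForallLayers P

/-- The form of the network, for the size parameter `m`: at most `2 ^ m` layers; in each layer the
state dimension is at most `m`, the output dimension is at most the number of layers, `A` takes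
values in `ℳ_n^n([-1,1])` and `B` takes values with natural number entries. -/
def IsGHNetwork {l p : ℕ} (m : ℕ) (N : LRNN d l p) : Prop :=
  N.depth ≤ 2 ^ m ∧
  N.ForallLayers fun _ n p' L =>
    (1 ≤ n ∧ n ≤ m) ∧ (1 ≤ p' ∧ p' ≤ N.depth) ∧ L.HasGHTransitions ∧ L.HasNatInputs

/-- The states of the network: tuples of states of all layers. -/
def State : {l p : ℕ} → LRNN d l p → Type
  | _, _, single (n := n) _ => Matrix (Fin n) (Fin d) ℂ
  | _, _, cons (n := n) _ N => Matrix (Fin n) (Fin d) ℂ × N.State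

/-- The tuple of the initial states of all layers. -/
def init : {l p : ℕ} → (N : LRNN d l p) → N.State
  | _, _, single L => L.H₀
  | _, _, cons L N => (L.H₀, N.init)

/-- The new states of all layers after the network reads one input `x`. -/
def next : {l p : ℕ} → (N : LRNN d l p) → N.State → (Fin l → ℝ) → N.State
  | _, _, single L, H, x => L.next H x
  | _, _, cons L N, S, x => (L.next S.1 x, N.next S.2 (L.dec (L.next S.1 x) x))

/-- The output of the last layer at the time step at which the network, being in the given state,
reads `x`. -/
def emit : {l p : ℕ} → (N : LRNN d l p) → N.State → (Fin l → ℝ) → Fin p → ℝ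
  | _, _, single L, H, x => L.dec (L.next H x) x
  | _, _, cons L N, S, x => N.emit S.2 (L.dec (L.next S.1 x) x)

/-- All numbers that occur in all layers when the network, being in the given state, reads `x`,
belong to `D`. -/
def ComputesIn (D : Set ℝ) : {l p : ℕ} → (N : LRNN d l p) → N.State → (Fin l → ℝ) → Prop
  | _, _, single L, H, x => L.ComputesIn D H x
  | _, _, cons L N, S, x =>
      L.ComputesIn D S.1 x ∧ N.ComputesIn D S.2 (L.dec (L.next S.1 x) x)

variable {l p : ℕ} {α : Type*}

/-- The states of all layers after reading the word `w`, whose letters are presented to the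
network through `enc`. -/
def run (N : LRNN d l p) (enc : α → Fin l → ℝ) (w : List α) : N.State :=
  w.foldl (fun S a => N.next S (enc a)) N.init

/-- The last output `y_t` of the last layer on the nonempty word `w a` of length `t`. -/
def output (N : LRNN d l p) (enc : α → Fin l → ℝ) (w : List α) (a : α) : Fin p → ℝ :=
  N.emit (N.run enc w) (enc a)

/-- The set of network states that occur on some word. -/
def reachable (N : LRNN d l p) (enc : α → Fin l → ℝ) : Set N.State :=
  Set.range (N.run enc)

/-- Finite precision: one finite set of real numbers contains every number that occurs in the
computations of the network on all words, of whatever length. -/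
def FinitePrecision (N : LRNN d l p) (enc : α → Fin l → ℝ) : Prop :=
  ∃ D : Set ℝ, D.Finite ∧ ∀ (w : List α) (a : α), N.ComputesIn D (N.run enc w) (enc a)

/-- The network, viewed as an automaton, implements `𝒜`: a function `g` from its reachable states
onto the reachable states of `𝒜` sends the initial state to the starting state and commutes with
the transitions. (Values of `g` outside the reachable states do not matter.) -/
def Implements {Q : Type*} (N : LRNN d l p) (enc : α → Fin l → ℝ) (𝒜 : FSA α Q) : Prop :=
  ∃ g : N.State → Q,
    g N.init = 𝒜.start ∧
    g '' N.reachable enc = 𝒜.reachable ∧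
    ∀ S ∈ N.reachable enc, ∀ a, 𝒜.δ (g S) a = g (N.next S (enc a))

/-- The network recognizes the language `K`: membership of any word (possibly empty) is determined
by the state reached on it, and on every nonempty word the last scalar output of the last layer
is `1` if the word belongs to `K` and `0` otherwise. -/
def Recognizes (N : LRNN d l 1) (enc : α → Fin l → ℝ) (K : Language α) : Prop :=
  (∃ F : Set N.State, ∀ w, w ∈ K ↔ N.run enc w ∈ F) ∧
  ∀ w a, (w ++ [a] ∈ K → N.output enc w a = fun _ => 1) ∧
    (w ++ [a] ∉ K → N.output enc w a = fun _ => 0)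

end LRNN

/-! The automaton is decomposed into a cascade in the spirit of Krohn and Rhodes, by induction on
the number of states (`exists_simulates_fin`). A first automaton tracks some state `x` different
from the current state `q`: bijective letters move `x` as they move `q`, any other letter resets `x`
to a point outside its image. Given `x`, the position of `q` in the complement of `x` ranges over
one state fewer, and its update depends only on the letter and on the new and old `x`. The induction
hypothesis handles it over the larger alphabet of such triples.

In one-hot coding a permutation letter is a permutation matrix and a reset is the zero matrix plus a
constant vector; both matrices are products of `n` generalized Householder matrices. A reset erases
the old `x`, so a two-dimensional shift layer recovers it. Each removed state costs two layers. -/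

/-! ### Products of generalized Householder matrices -/

theorem ghMatrix_mul_mem_ghProducts {n k : ℕ} {Ω : Set ℝ} {β : ℝ} {v : EuclideanSpace ℝ (Fin n)}
    {M : Matrix (Fin n) (Fin n) ℝ} (hβ : 1 - β ∈ Ω) (hv : ‖v‖ = 1) (hM : M ∈ ghProducts n k Ω) :
    ghMatrix β v * M ∈ ghProducts n (k + 1) Ω := by
  obtain ⟨b, u, hb, hu, rfl⟩ := hM
  refine ⟨Fin.cons β b, Fin.cons v u, ?_, ?_, ?_⟩
  · intro i
    cases i using Fin.cases <;> simp [hβ, hb]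
  · intro i
    cases i using Fin.cases <;> simp [hv, hu]
  · simp [List.ofFn_succ]

theorem one_mem_ghProducts {n k : ℕ} {Ω : Set ℝ} (hn : 0 < n) (hΩ : 1 ∈ Ω) :
    (1 : Matrix (Fin n) (Fin n) ℝ) ∈ ghProducts n k Ω := by
  refine ⟨fun _ => 0, fun _ => EuclideanSpace.single ⟨0, hn⟩ 1, ?_, ?_, ?_⟩
  · exact fun _ => by simpa using hΩ
  · simp
  · simp [ghMatrix]

theorem ghMatrix_one_single {n : ℕ} (i : Fin n) :
    ghMatrix 1 (EuclideanSpace.single i (1 : ℝ)) =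
      Matrix.diagonal fun j => if j = i then 0 else 1 := by
  ext a b
  simp only [ghMatrix, one_smul, Matrix.sub_apply, Matrix.one_apply, Matrix.vecMulVec_apply,
    Matrix.diagonal_apply, PiLp.single_apply]
  split_ifs <;> simp_all

/-- The `n` projections with `β = 1` along the basis vectors kill one coordinate each. -/
theorem zero_mem_ghProducts {n : ℕ} {Ω : Set ℝ} (hΩ : 0 ∈ Ω) :
    (0 : Matrix (Fin n) (Fin n) ℝ) ∈ ghProducts n n Ω := by
  refine ⟨fun _ => 1, fun i => EuclideanSpace.single i 1, ?_, ?_, ?_⟩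
  · exact fun _ => by simpa using hΩ
  · simp
  · simp_rw [ghMatrix_one_single]
    have h : (fun i : Fin n => Matrix.diagonal fun j => if j = i then (0 : ℝ) else 1) =
        (Matrix.diagonalRingHom (Fin n) ℝ) ∘ fun i j => if j = i then 0 else 1 := by
      ext; rfl
    rw [h, ← List.map_ofFn, ← map_list_prod, List.prod_ofFn]
    ext a b
    by_cases hab : a = b
    · subst hab
      simp [Finset.prod_apply]
    · simp [hab]

/-- The reflection along `(e_i - e_j) / √2` exchanges the two basis vectors. -/
theorem exists_ghMatrix_eq_swap {n : ℕ} {i j : Fin n} (hij : i ≠ j) :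
    ∃ v : EuclideanSpace ℝ (Fin n), ‖v‖ = 1 ∧
      ghMatrix 2 v = (Equiv.swap i j).permMatrix ℝ := by
  have h2 : (√2)⁻¹ * (√2)⁻¹ = (2 : ℝ)⁻¹ := by
    rw [← mul_inv, Real.mul_self_sqrt (by norm_num)]
  refine ⟨(√2)⁻¹ • (EuclideanSpace.single i 1 - EuclideanSpace.single j 1), ?_, ?_⟩
  · have h : ‖EuclideanSpace.single i (1 : ℝ) - EuclideanSpace.single j 1‖ ^ 2 = 2 := by
      rw [norm_sub_sq_real]
      norm_num [EuclideanSpace.inner_single_left, hij]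
    rw [← sq_eq_sq₀ (norm_nonneg _) zero_le_one, norm_smul, mul_pow, h, Real.norm_eq_abs, sq_abs,
      sq, h2]
    norm_num
  · ext a b
    simp only [ghMatrix, Matrix.sub_apply, Matrix.one_apply, Matrix.vecMulVec_apply,
      Matrix.smul_apply, WithLp.ofLp_smul, WithLp.ofLp_sub, Pi.smul_apply, Pi.sub_apply,
      PiLp.single_apply, smul_eq_mul, PEquiv.toMatrix_apply, Equiv.Perm.permMatrix,
      Equiv.toPEquiv_apply, Option.mem_some_iff, Equiv.swap_apply_def]
    have e : ∀ s t : ℝ, 2 * ((√2)⁻¹ * s * ((√2)⁻¹ * t)) = s * t := fun s t => by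
      linear_combination 2 * s * t * h2
    rw [e]
    grind

/-- Splitting off a suitable transposition shrinks the support by at least one; unused factors are
identities (`β = 0`). -/
theorem permMatrix_mem_ghProducts {n : ℕ} (hn : 0 < n) (k : ℕ) (σ : Equiv.Perm (Fin n))
    (hσ : σ.support.card ≤ k) : σ.permMatrix ℝ ∈ ghProducts n k (Set.Icc (-1) 1) := by
  induction k generalizing σ with
  | zero =>
    have : σ = 1 := by simpa using hσ
    subst this
    simpa using one_mem_ghProducts (k := 0) hn (Ω := Set.Icc (-1) 1) (by simp)
  | succ k ih =>
    by_cases h1 : σ = 1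
    · subst h1
      simpa using one_mem_ghProducts (k := k + 1) hn (Ω := Set.Icc (-1) 1) (by simp)
    -- `permMatrix` reverses products, so a reflection on the left is a swap on the right of `σ`,
    -- that is, on the left of `σ⁻¹`.
    · obtain ⟨x, hx⟩ : ∃ x, σ⁻¹ x ≠ x := by
        by_contra! h
        exact h1 (inv_eq_one.1 (Equiv.ext h))
      have hlt := Equiv.Perm.card_support_swap_mul hx
      obtain ⟨v, hv, hsw⟩ := exists_ghMatrix_eq_swap hx.symm
      have := ghMatrix_mul_mem_ghProducts (β := 2) (Ω := Set.Icc (-1) 1) (by norm_num) hv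
        (ih (Equiv.swap x (σ⁻¹ x) * σ⁻¹)⁻¹ (by
          rw [Equiv.Perm.support_inv]
          rw [Equiv.Perm.support_inv] at hlt
          omega))
      rw [hsw, ← Matrix.permMatrix_mul] at this
      simpa using this

/-- Project away coordinate 1, then swap the coordinates. -/
theorem shift_mem_ghProducts :
    (!![0, 0; 1, 0] : Matrix (Fin 2) (Fin 2) ℝ) ∈ ghProducts 2 2 (Set.Icc (-1) 1) := by
  obtain ⟨v, hv, hsw⟩ := exists_ghMatrix_eq_swap (n := 2) (i := 0) (j := 1) (by simp)
  have h := ghMatrix_mul_mem_ghProducts (β := 2) (Ω := Set.Icc (-1) 1) (by norm_num) hv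
    (ghMatrix_mul_mem_ghProducts (β := 1) (v := EuclideanSpace.single 1 1) (by norm_num) (by simp)
      (one_mem_ghProducts (k := 0) (by norm_num) (by simp)))
  convert h using 1
  rw [hsw, ghMatrix_one_single]
  ext i j
  fin_cases i <;> fin_cases j <;>
    simp [Matrix.mul_apply, Equiv.Perm.permMatrix, PEquiv.toMatrix_apply]

/-! ### Numbers occurring in a single step -/

namespace LRNNLayer

variable {l n d p : ℕ}

theorem ComputesIn.mono {D D' : Set ℝ} (hD : D ⊆ D') {L : LRNNLayer l n d p}
    {H : Matrix (Fin n) (Fin d) ℂ} {x : Fin l → ℝ} (h : L.ComputesIn D H x) :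
    L.ComputesIn D' H x := by
  obtain ⟨h1, h2, h3, h4, h5, h6, h7⟩ := h
  refine ⟨fun i => hD (h1 i), fun i j => ?_, fun i j => ?_, fun i j => ?_, fun i j T => ?_,
    fun i j => ?_, fun i => hD (h7 i)⟩
  · obtain ⟨r, hr, e⟩ := h2 i j
    exact ⟨r, hD hr, e⟩
  · obtain ⟨r, hr, e⟩ := h3 i j
    exact ⟨r, hD hr, e⟩
  · obtain ⟨r, hr, e⟩ := h4 i j
    exact ⟨r, hD hr, e⟩
  · obtain ⟨r, hr, e⟩ := h5 i j T
    exact ⟨r, hD hr, e⟩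
  · obtain ⟨r, hr, e⟩ := h6 i j
    exact ⟨r, hD hr, e⟩

/-- One step involves finitely many numbers, so only their being real needs proof. -/
theorem exists_finite_computesIn {L : LRNNLayer l n d p} (hA : L.HasGHTransitions)
    (hB : L.HasNatInputs) {H : Matrix (Fin n) (Fin d) ℂ} (hH : ∀ i j, (H i j).im = 0)
    (x : Fin l → ℝ) : ∃ D : Set ℝ, D.Finite ∧ L.ComputesIn D H x := by
  have hre : ∀ z : ℂ, z.im = 0 → z = ((z.re : ℝ) : ℂ) := fun z hz =>
    Complex.ext rfl (by simpa using hz)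
  have hAim : ∀ i j, (L.A x i j).im = 0 := fun i j => by
    obtain ⟨M, -, hM⟩ := hA x
    simp [hM]
  have hBim : ∀ i j, (L.B x i j).im = 0 := fun i j => by
    obtain ⟨m, hm⟩ := hB x i j
    simp [hm]
  have hsum : ∀ i j (T : Finset (Fin n)), (∑ k ∈ T, L.A x i k * H k j).im = 0 := fun i j T => by
    simp [Complex.im_sum, hAim, hH]
  have hnext : ∀ i j, (L.next H x i j).im = 0 := fun i j => by
    simp [next, Matrix.mul_apply, hsum, hBim, -Complex.im_sum]
  refine ⟨Set.range x ∪ (Set.range fun q : Fin n × Fin n => (L.A x q.1 q.2).re) ∪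
    (Set.range fun q : Fin n × Fin d => (L.B x q.1 q.2).re) ∪
    (Set.range fun q : Fin n × Fin d => (H q.1 q.2).re) ∪
    (Set.range fun q : Fin n × Fin d × Finset (Fin n) =>
      (∑ k ∈ q.2.2, L.A x q.1 k * H k q.2.1).re) ∪
    (Set.range fun q : Fin n × Fin d => (L.next H x q.1 q.2).re) ∪
    Set.range (L.dec (L.next H x) x), ?_, ?_⟩
  · simp only [Set.finite_union, Set.finite_range, and_self]
  · refine ⟨fun i => by simp, fun i j => ⟨_, ?_, hre _ (hAim i j)⟩,
      fun i j => ⟨_, ?_, hre _ (hBim i j)⟩, fun i j => ⟨_, ?_, hre _ (hH i j)⟩,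
      fun i j T => ⟨_, ?_, hre _ (hsum i j T)⟩, fun i j => ⟨_, ?_, hre _ (hnext i j)⟩,
      fun i => by simp⟩
    · exact .inl <| .inl <| .inl <| .inl <| .inl <| .inr ⟨(i, j), rfl⟩
    · exact .inl <| .inl <| .inl <| .inl <| .inr ⟨(i, j), rfl⟩
    · exact .inl <| .inl <| .inl <| .inr ⟨(i, j), rfl⟩
    · exact .inl <| .inl <| .inr ⟨(i, j, T), rfl⟩
    · exact .inl <| .inr ⟨(i, j), rfl⟩

end LRNNLayer

/-! ### Simulation of automata, quotients and cascades -/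

namespace LRNN

theorem ComputesIn.mono {d : ℕ} {D D' : Set ℝ} (hD : D ⊆ D') : ∀ {l p : ℕ} {N : LRNN d l p}
    {S : N.State} {x : Fin l → ℝ}, N.ComputesIn D S x → N.ComputesIn D' S x
  | _, _, single _, _, _, h => LRNNLayer.ComputesIn.mono hD h
  | _, _, cons _ _, _, _, h => ⟨LRNNLayer.ComputesIn.mono hD h.1, ComputesIn.mono hD h.2⟩

theorem ForallLayers.imp {d : ℕ} {P P' : (l n p : ℕ) → LRNNLayer l n d p → Prop}
    (hP : ∀ l n p L, P l n p L → P' l n p L) : ∀ {l p : ℕ} {N : LRNN d l p},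
    N.ForallLayers P → N.ForallLayers P'
  | _, _, single _, h => hP _ _ _ _ h
  | _, _, cons _ _, h => ⟨hP _ _ _ _ h.1, ForallLayers.imp hP h.2⟩

variable {d l p : ℕ} {α Q : Type*}

/-- On an invariant set of states, the network computes with a finite set of numbers and the
automaton is a quotient of it, such that the network emits `out q a` when it is in a state lying
over `q` and reads `a`. -/
def Simulates (N : LRNN d l p) (enc : α → Fin l → ℝ) (𝒜 : FSA α Q)
    (out : Q → α → Fin p → ℝ) : Prop :=
  ∃ (I : Set N.State) (g : N.State → Q) (D : Set ℝ),
    D.Finite ∧ N.init ∈ I ∧ g N.init = 𝒜.start ∧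
    ∀ S ∈ I, ∀ a, N.next S (enc a) ∈ I ∧ g (N.next S (enc a)) = 𝒜.δ (g S) a ∧
      N.emit S (enc a) = out (g S) a ∧ N.ComputesIn D S (enc a)

/-- Cascades have junk states; the invariant `P` confines the quotient map to the consistent ones.
-/
theorem Simulates.map {N : LRNN d l p} {enc : α → Fin l → ℝ} {Q' : Type*} {𝒜 : FSA α Q}
    {ℬ : FSA α Q'} {out : Q → α → Fin p → ℝ} {out' : Q' → α → Fin p → ℝ}
    (h : N.Simulates enc 𝒜 out) (π : Q → Q') (P : Q → Prop) (hP₀ : P 𝒜.start)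
    (hP : ∀ q a, P q → P (𝒜.δ q a)) (h₀ : π 𝒜.start = ℬ.start)
    (hδ : ∀ q a, P q → π (𝒜.δ q a) = ℬ.δ (π q) a)
    (hout : ∀ q a, P q → out q a = out' (π q) a) :
    N.Simulates enc ℬ out' := by
  obtain ⟨I, g, D, hD, hI, hg, H⟩ := h
  refine ⟨{S | S ∈ I ∧ P (g S)}, π ∘ g, D, hD, ⟨hI, hg ▸ hP₀⟩, by simp [hg, h₀],
    fun S hS a => ?_⟩
  obtain ⟨h1, h2, h3, h4⟩ := H S hS.1 a
  exact ⟨⟨h1, h2 ▸ hP _ a hS.2⟩, by simp [h2, hδ _ a hS.2], by simp [h3, hout _ a hS.2], h4⟩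

theorem Simulates.cons {k : ℕ} {β X Z : Type*} {n : ℕ} {L : LRNNLayer l n d k} {N : LRNN d k p}
    {enc : α → Fin l → ℝ} {enc' : β → Fin k → ℝ} {𝒞 : FSA α X} {ℬ : FSA β Z} {o : X → α → β}
    {out : Z → β → Fin p → ℝ} (hL : (single L).Simulates enc 𝒞 fun x a => enc' (o x a))
    (hN : N.Simulates enc' ℬ out) :
    (LRNN.cons L N).Simulates enc
      (⟨(𝒞.start, ℬ.start), fun q a => (𝒞.δ q.1 a, ℬ.δ q.2 (o q.1 a))⟩ : FSA α (X × Z))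
      fun q a => out q.2 (o q.1 a) := by
  obtain ⟨I, g, D, hD, hI, hg, H⟩ := hL
  obtain ⟨I', g', D', hD', hI', hg', H'⟩ := hN
  refine ⟨{S | S.1 ∈ I ∧ S.2 ∈ I'}, fun S => (g S.1, g' S.2), D ∪ D', hD.union hD', ⟨hI, hI'⟩,
    Prod.ext hg hg', ?_⟩
  rintro ⟨S, S'⟩ ⟨hS, hS'⟩ a
  obtain ⟨h1, h2, h3, h4⟩ := H S hS a
  obtain ⟨h1', h2', h3', h4'⟩ := H' S' hS' (o (g S) a)
  have h3 : L.dec (L.next S (enc a)) (enc a) = enc' (o (g S) a) := h3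
  refine ⟨⟨h1, ?_⟩, Prod.ext h2 ?_, ?_, ?_, ?_⟩
  · simpa only [LRNN.next, h3] using h1'
  · simpa only [LRNN.next, h3] using h2'
  · simpa only [LRNN.emit, h3] using h3'
  · exact LRNNLayer.ComputesIn.mono Set.subset_union_left h4
  · rw [h3]
    exact h4'.mono Set.subset_union_right

/-! ### Automata simulated by one layer -/

/-- If states are coded by integer vectors on which letters act affinely, only finitely many
matrices `H q` ever occur. This gives finite precision, and the arbitrary decoder can invert the
coding. -/
theorem exists_layer_simulates [Finite α] [Finite Q] {n : ℕ} (hn : 0 < n) {enc : α → Fin l → ℝ}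
    (henc : Function.Injective enc) (𝒜 : FSA α Q) {h : Q → Fin n → ℕ} (hh : Function.Injective h)
    {A : α → Matrix (Fin n) (Fin n) ℝ} (hA : ∀ a, A a ∈ ghProducts n n (Set.Icc (-1) 1))
    {b : α → Fin n → ℕ}
    (hδ : ∀ q a i, ∑ j, A a i j * h q j + b a i = h (𝒜.δ q a) i)
    (out : Q → α → Fin p → ℝ) :
    ∃ L : LRNNLayer l n 1 p, L.HasGHTransitions ∧ L.HasNatInputs ∧
      (single L).Simulates enc 𝒜 fun q a => out (𝒜.δ q a) a := by
  classical
  have : Nonempty Q := ⟨𝒜.start⟩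
  let H : Q → Matrix (Fin n) (Fin 1) ℂ := fun q => Matrix.of fun i _ => (h q i : ℂ)
  have hH : Function.Injective H := fun q q' e => hh <| funext fun i => by
    have e' : (h q i : ℂ) = h q' i := congrFun (congrFun e i) 0
    exact_mod_cast e'
  -- Off the alphabet `A` defaults to the identity, since the form of `A` is required on all of
  -- `ℝ^l`.
  let L : LRNNLayer l n 1 p :=
    { H₀ := H 𝒜.start
      A := fun x => (Function.extend enc A (fun _ => 1) x).map fun r : ℝ => (r : ℂ)
      B := fun x => Matrix.of fun i _ => (Function.extend enc b (fun _ => 0) x i : ℂ)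
      dec := fun S x => Function.extend enc (out (Function.invFun H S)) (fun _ => 0) x }
  have hLA : L.HasGHTransitions := fun x => by
    refine ⟨_, ?_, rfl⟩
    by_cases hx : ∃ a, enc a = x
    · obtain ⟨a, rfl⟩ := hx
      rw [henc.extend_apply]
      exact hA a
    · rw [Function.extend_apply' _ _ _ hx]
      exact one_mem_ghProducts hn (by simp)
  have hLB : L.HasNatInputs := fun x i j => ⟨_, rfl⟩
  have hnext : ∀ q a, L.next (H q) (enc a) = H (𝒜.δ q a) := fun q a => by
    ext i j
    have := hδ q a i
    simp only [LRNNLayer.next, L, H, henc.extend_apply, Matrix.add_apply, Matrix.mul_apply,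
      Matrix.map_apply, Matrix.of_apply]
    exact_mod_cast congrArg (fun r : ℝ => (r : ℂ)) this
  have hfin : ∀ q : Q, ∀ a, ∃ D : Set ℝ, D.Finite ∧ L.ComputesIn D (H q) (enc a) := fun q a =>
    LRNNLayer.exists_finite_computesIn hLA hLB (fun i j => by simp [H]) _
  choose D hD hcomp using hfin
  refine ⟨L, hLA, hLB, Set.range H, Function.invFun H, ⋃ q, ⋃ a, D q a,
    Set.finite_iUnion fun q => Set.finite_iUnion fun a => hD q a, ⟨_, rfl⟩,
    Function.leftInverse_invFun hH _, ?_⟩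
  rintro _ ⟨q, rfl⟩ a
  have hinv : ∀ q, Function.invFun H (H q) = q := Function.leftInverse_invFun hH
  refine ⟨⟨_, (hnext q a).symm⟩, ?_, ?_, ?_⟩
  · change Function.invFun H (L.next (H q) (enc a)) = 𝒜.δ (Function.invFun H (H q)) a
    rw [hnext, hinv, hinv]
  · change L.dec (L.next (H q) (enc a)) (enc a) = out (𝒜.δ (Function.invFun H (H q)) a) a
    rw [hnext, hinv]
    simp only [L, henc.extend_apply, hinv]
  · exact (hcomp q a).mono <| Set.subset_iUnion_of_subset q <| Set.subset_iUnion (D q) a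

/-- A layer for an automaton in which every letter acts as a permutation or as a constant map. -/
theorem exists_layer_simulates_permutation_reset [Finite α] {n : ℕ} {enc : α → Fin l → ℝ}
    (henc : Function.Injective enc) (𝒜 : FSA α (Fin n))
    (h𝒜 : ∀ a, (Function.Bijective fun q => 𝒜.δ q a) ∨ ∃ y, ∀ q, 𝒜.δ q a = y)
    (out : Fin n → α → Fin p → ℝ) :
    ∃ L : LRNNLayer l n 1 p, L.HasGHTransitions ∧ L.HasNatInputs ∧
      (single L).Simulates enc 𝒜 fun q a => out (𝒜.δ q a) a := by
  have hn : 0 < n := 𝒜.start.pos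
  have key : ∀ a, ∃ (A : Matrix (Fin n) (Fin n) ℝ) (b : Fin n → ℕ),
      A ∈ ghProducts n n (Set.Icc (-1) 1) ∧
      ∀ q i, ∑ j, A i j * ((Pi.single q 1 : Fin n → ℕ) j : ℝ) + b i =
        (Pi.single (𝒜.δ q a) 1 : Fin n → ℕ) i := fun a => by
    rcases h𝒜 a with hbij | ⟨y, hy⟩
    · let σ := Equiv.ofBijective _ hbij
      -- The inverse, because `σ.permMatrix` sends `e_q` to the basis vector at `σ⁻¹ q`.
      refine ⟨(σ⁻¹ : Equiv.Perm (Fin n)).permMatrix ℝ, 0, permMatrix_mem_ghProducts hn _ _ ?_, ?_⟩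
      · simpa using Finset.card_le_univ (σ⁻¹ : Equiv.Perm (Fin n)).support
      · intro q i
        have hq : 𝒜.δ q a = σ q := rfl
        simp [Pi.single_apply, Equiv.Perm.permMatrix, PEquiv.toMatrix_apply, hq,
          Equiv.symm_apply_eq]
    · exact ⟨0, Pi.single y 1, zero_mem_ghProducts (by simp), fun q i => by simp [hy]⟩
  choose A b hA hδ using key
  refine exists_layer_simulates hn henc 𝒜 (h := fun q => Pi.single q 1) ?_ hA
    (fun q a i => hδ a q i) out
  intro q q' h
  by_contra hne
  simpa [hne] using congrFun h q

/-- A layer that remembers the previous value of a function of its input. -/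
theorem exists_layer_simulates_delay [Finite α] {X : Type*} [Finite X] {enc : α → Fin l → ℝ}
    (henc : Function.Injective enc) (c : α → X) (x₀ : X) (out : X × X → α → Fin p → ℝ) :
    ∃ L : LRNNLayer l 2 1 p, L.HasGHTransitions ∧ L.HasNatInputs ∧
      (single L).Simulates enc (⟨(x₀, x₀), fun q a => (c a, q.1)⟩ : FSA α (X × X))
        fun q a => out (c a, q.1) a := by
  obtain ⟨e, he⟩ := Countable.exists_injective_nat X
  refine exists_layer_simulates (by norm_num) henc _ (h := fun q => ![e q.1, e q.2]) ?_
    (A := fun _ => !![0, 0; 1, 0]) (fun _ => shift_mem_ghProducts) (b := fun a => ![e (c a), 0])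
    ?_ out
  · rintro ⟨x, y⟩ ⟨x', y'⟩ h
    exact Prod.ext (he (congrFun h 0)) (he (congrFun h 1))
  · intro q a i
    fin_cases i <;> simp

/-! ### The cascade decomposition -/

theorem exists_simulates_fin (k : ℕ) {α : Type*} [Finite α] {l : ℕ} {enc : α → Fin l → ℝ}
    (henc : Function.Injective enc) (𝒜 : FSA α (Fin (k + 1))) (f : Fin (k + 1) → α → ℝ) :
    ∃ N : LRNN 1 l 1, N.depth = 2 * k + 1 ∧
      N.ForallLayers (fun _ n p L =>
        (1 ≤ n ∧ n ≤ k + 1) ∧ p = 1 ∧ L.HasGHTransitions ∧ L.HasNatInputs) ∧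
      N.Simulates enc 𝒜 fun q a _ => f (𝒜.δ q a) a := by
  induction k generalizing α l with
  | zero =>
    obtain ⟨L, hA, hB, hL⟩ := exists_layer_simulates_permutation_reset henc 𝒜
      (fun a => .inr ⟨0, fun q => Fin.fin_one_eq_zero _⟩) fun q a (_ : Fin 1) => f q a
    exact ⟨single L, rfl, ⟨by simp, rfl, hA, hB⟩, hL⟩
  | succ k ih =>
    classical
    have hy : ∀ a, ∃ y, ¬ (Function.Bijective fun q => 𝒜.δ q a) → ∀ q, 𝒜.δ q a ≠ y := fun a => by
      by_cases hb : Function.Bijective fun q => 𝒜.δ q a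
      · exact ⟨0, fun h => (h hb).elim⟩
      · have hs : ¬ Function.Surjective fun q => 𝒜.δ q a := fun hs =>
          hb (Finite.surjective_iff_bijective.1 hs)
        simp only [Function.Surjective, not_forall, not_exists] at hs
        exact hs.imp fun y hy _ => hy
    choose y hy using hy
    obtain ⟨x₀, hx₀⟩ := exists_ne 𝒜.start
    obtain ⟨z₀, hz₀⟩ := Fin.exists_succAbove_eq hx₀.symm
    -- the automaton of a state that is different from the current one
    let 𝒞 : FSA α (Fin (k + 2)) :=
      ⟨x₀, fun x a => if Function.Bijective fun q => 𝒜.δ q a then 𝒜.δ x a else y a⟩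
    -- The tracked state stays different from the current one: by injectivity for bijective letters,
    -- by the choice of `y a` otherwise.
    have h𝒞 : ∀ x z a, ∃ z', (𝒞.δ x a).succAbove z' = 𝒜.δ (x.succAbove z) a := fun x z a => by
      refine Fin.exists_succAbove_eq ?_
      by_cases hb : Function.Bijective fun q => 𝒜.δ q a
      · simp only [𝒞, if_pos hb]
        exact fun h => Fin.succAbove_ne x z (hb.1 h)
      · simp only [𝒞, if_neg hb]
        exact hy a hb _
    -- A letter of the smaller automaton is (letter, new `x`, old `x`); inconsistent triples are
    -- unconstrained.
    have hdec : ∀ (b : α × Fin (k + 2) × Fin (k + 2)) (z : Fin (k + 1)), ∃ z',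
        b.2.1 = 𝒞.δ b.2.2 b.1 → b.2.1.succAbove z' = 𝒜.δ (b.2.2.succAbove z) b.1 := by
      rintro ⟨a, x', x⟩ z
      obtain ⟨z', hz'⟩ := h𝒞 x z a
      exact ⟨z', fun h => by
        change x' = 𝒞.δ x a at h
        subst h
        exact hz'⟩
    choose ζ hζ using hdec
    let ℬ : FSA (α × Fin (k + 2) × Fin (k + 2)) (Fin (k + 1)) := ⟨z₀, fun z b => ζ b z⟩
    -- Coding each tuple by one number keeps all output dimensions equal to 1.
    obtain ⟨e, he⟩ := Countable.exists_injective_nat (α × Fin (k + 2))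
    obtain ⟨e', he'⟩ := Countable.exists_injective_nat (α × Fin (k + 2) × Fin (k + 2))
    let enc₁ : α × Fin (k + 2) → Fin 1 → ℝ := fun b _ => e b
    let enc₂ : α × Fin (k + 2) × Fin (k + 2) → Fin 1 → ℝ := fun b _ => e' b
    have henc₁ : Function.Injective enc₁ := fun b b' h => he (Nat.cast_injective (congrFun h 0))
    have henc₂ : Function.Injective enc₂ := fun b b' h => he' (Nat.cast_injective (congrFun h 0))
    obtain ⟨L, hA, hB, hL⟩ := exists_layer_simulates_permutation_reset henc 𝒞
      (fun a => by
        by_cases hb : Function.Bijective fun q => 𝒜.δ q a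
        · left
          simpa only [𝒞, if_pos hb] using hb
        · exact .inr ⟨y a, fun q => if_neg hb⟩) fun x a => enc₁ (a, x)
    obtain ⟨L', hA', hB', hL'⟩ := exists_layer_simulates_delay henc₁ Prod.snd x₀
      fun q b => enc₂ (b.1, q)
    obtain ⟨N, hdepth, hlayers, hN⟩ := ih henc₂ ℬ fun z b => f (b.2.1.succAbove z) b.1
    refine ⟨cons L (cons L' N), by simp only [depth, hdepth]; ring,
      ⟨⟨by omega, rfl, hA, hB⟩, ⟨by omega, rfl, hA', hB'⟩,
        hlayers.imp fun _ _ _ _ h => ⟨⟨h.1.1, by omega⟩, h.2⟩⟩, ?_⟩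
    have hsim := Simulates.cons (o := fun x a => (a, 𝒞.δ x a)) hL
      (Simulates.cons (o := fun (q : Fin (k + 2) × Fin (k + 2)) b => (b.1, b.2, q.1)) hL' hN)
    -- Invariant: the newest value stored in the delay layer is the tracked state, so at the next
    -- step it is emitted as the old `x`.
    refine hsim.map (fun q => q.1.succAbove q.2.2) (fun q => q.2.1.1 = q.1) rfl (fun _ _ _ => rfl)
      hz₀ ?_ ?_
    · rintro ⟨x, ⟨x', x''⟩, z⟩ a h
      change x' = x at h
      subst h
      exact hζ (a, 𝒞.δ x' a, x') z rfl
    · rintro ⟨x, ⟨x', x''⟩, z⟩ a h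
      change x' = x at h
      subst h
      funext
      exact congrArg (f · a) (hζ (a, 𝒞.δ x' a, x') z rfl)

/-! ### From simulation to implementation and recognition -/

theorem run_append_singleton (N : LRNN d l p) (enc : α → Fin l → ℝ) (w : List α) (a : α) :
    N.run enc (w ++ [a]) = N.next (N.run enc w) (enc a) := by
  simp [run]

theorem _root_.FSA.eval_append_singleton (𝒜 : FSA α Q) (w : List α) (a : α) :
    𝒜.eval (w ++ [a]) = 𝒜.δ (𝒜.eval w) a := by
  simp [FSA.eval]

theorem Simulates.exists_forall_run {N : LRNN d l p} {enc : α → Fin l → ℝ} {𝒜 : FSA α Q}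
    {out : Q → α → Fin p → ℝ} (h : N.Simulates enc 𝒜 out) :
    N.FinitePrecision enc ∧ (∃ g : N.State → Q, ∀ w, g (N.run enc w) = 𝒜.eval w) ∧
      ∀ w a, N.output enc w a = out (𝒜.eval w) a := by
  obtain ⟨I, g, D, hD, hI, hg, H⟩ := h
  have key : ∀ w, N.run enc w ∈ I ∧ g (N.run enc w) = 𝒜.eval w := fun w => by
    induction w using List.reverseRecOn with
    | nil => exact ⟨hI, hg⟩
    | append_singleton w a ih =>
      obtain ⟨h1, h2, -, -⟩ := H _ ih.1 a
      rw [run_append_singleton, FSA.eval_append_singleton, h2, ih.2]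
      exact ⟨h1, rfl⟩
  refine ⟨⟨D, hD, fun w a => (H _ (key w).1 a).2.2.2⟩, ⟨g, fun w => (key w).2⟩, fun w a => ?_⟩
  rw [← (key w).2]
  exact (H _ (key w).1 a).2.2.1

theorem implements_of_forall_run {N : LRNN d l p} {enc : α → Fin l → ℝ} {𝒜 : FSA α Q}
    {g : N.State → Q} (hg : ∀ w, g (N.run enc w) = 𝒜.eval w) : N.Implements enc 𝒜 := by
  refine ⟨g, hg [], ?_, ?_⟩
  · rw [reachable, ← Set.range_comp]
    exact congrArg Set.range (funext hg)
  · rintro _ ⟨w, rfl⟩ a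
    rw [← run_append_singleton, hg, hg, FSA.eval_append_singleton]

theorem exists_isGHNetwork [Finite α] [Fintype Q] {enc : α → Fin l → ℝ}
    (henc : Function.Injective enc) (𝒜 : FSA α Q) (f : Q → ℝ) :
    ∃ N : LRNN 1 l 1, N.IsGHNetwork (Fintype.card Q) ∧ N.FinitePrecision enc ∧
      (∃ g : N.State → Q, ∀ w, g (N.run enc w) = 𝒜.eval w) ∧
      ∀ w a, N.output enc w a = fun _ => f (𝒜.eval (w ++ [a])) := by
  obtain ⟨k, hk⟩ : ∃ k, Fintype.card Q = k + 1 :=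
    Nat.exists_eq_succ_of_ne_zero (Fintype.card_pos_iff.2 ⟨𝒜.start⟩).ne'
  let e : Q ≃ Fin (k + 1) := Fintype.equivFinOfCardEq hk
  obtain ⟨N, hdepth, hlayers, hN⟩ := exists_simulates_fin k henc
    (⟨e 𝒜.start, fun q a => e (𝒜.δ (e.symm q) a)⟩ : FSA α (Fin (k + 1))) fun q _ => f (e.symm q)
  have hN' : N.Simulates enc 𝒜 fun q a _ => f (𝒜.δ q a) :=
    hN.map e.symm (fun _ => True) trivial (fun _ _ _ => trivial) (by simp) (by simp) (by simp)
  obtain ⟨h1, h2, h3⟩ := hN'.exists_forall_run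
  refine ⟨N, ⟨?_, hlayers.imp ?_⟩, h1, h2, fun w a => by rw [h3, FSA.eval_append_singleton]⟩
  -- `2k + 1 ≤ 2 ^ (k + 1)` follows from `k < 2 ^ k`.
  · have := Nat.lt_two_pow_self (n := k)
    rw [hdepth, hk, pow_succ]
    omega
  · rintro l n p L ⟨hn, rfl, hA, hB⟩
    exact ⟨hk ▸ hn, ⟨le_rfl, by omega⟩, hA, hB⟩

theorem exists_isGHNetwork_recognizes [Finite α] [Fintype Q] {enc : α → Fin l → ℝ}
    (henc : Function.Injective enc) (𝒜 : FSA α Q) (R : Set Q) :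
    ∃ N : LRNN 1 l 1, N.IsGHNetwork (Fintype.card Q) ∧ N.FinitePrecision enc ∧
      N.Recognizes enc (𝒜.language R) := by
  classical
  obtain ⟨N, h1, h2, ⟨g, hg⟩, h3⟩ := exists_isGHNetwork henc 𝒜 fun q => if q ∈ R then 1 else 0
  have hmem : ∀ w, w ∈ 𝒜.language R ↔ 𝒜.eval w ∈ R := fun _ => Iff.rfl
  refine ⟨N, h1, h2, ⟨g ⁻¹' R, fun w => ?_⟩, fun w a => ⟨fun h => ?_, fun h => ?_⟩⟩
  · rw [hmem, Set.mem_preimage, hg]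
  · rw [h3, if_pos ((hmem _).1 h)]
  · rw [h3, if_neg (mt (hmem _).2 h)]

end LRNN

theorem mainTheorem1 {α : Type*} [Fintype α] {l : ℕ}
    (enc : α → Fin l → ℝ) (henc : Function.Injective enc) :
    (∀ (Q : Type*) [Fintype Q] (𝒜 : FSA α Q),
      (∃ (p : ℕ) (N : LRNN 1 l p),
        N.IsGHNetwork (Fintype.card Q) ∧
        N.FinitePrecision enc ∧
        N.Implements enc 𝒜 ∧
        ∃ r : (Fin p → ℝ) → Q, ∀ w a, r (N.output enc w a) = 𝒜.eval (w ++ [a])) ∧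
      (∀ R : Set Q, ∃ N : LRNN 1 l 1,
        N.IsGHNetwork (Fintype.card Q) ∧
        N.FinitePrecision enc ∧
        N.Recognizes enc (𝒜.language R))) ∧
    (∀ K : Language α, K.IsRegular →
      ∃ (m : ℕ) (N : LRNN 1 l 1),
        N.IsGHNetwork m ∧
        N.FinitePrecision enc ∧
        N.Recognizes enc K) := by
  refine ⟨fun Q _ 𝒜 => ⟨?_, LRNN.exists_isGHNetwork_recognizes henc 𝒜⟩, ?_⟩
  · obtain ⟨c, hc⟩ := Countable.exists_injective_nat Q
    obtain ⟨N, h1, h2, ⟨g, hg⟩, h3⟩ := LRNN.exists_isGHNetwork henc 𝒜 fun q => (c q : ℝ)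
    have hinj : Function.Injective fun q (_ : Fin 1) => (c q : ℝ) := fun q q' h =>
      hc (Nat.cast_injective (congrFun h 0))
    have : Nonempty Q := ⟨𝒜.start⟩
    exact ⟨1, N, h1, h2, LRNN.implements_of_forall_run hg,
      Function.invFun fun q (_ : Fin 1) => (c q : ℝ),
      fun w a => by rw [h3]; exact Function.leftInverse_invFun hinj _⟩
  · rintro K ⟨σ, _, M, rfl⟩
    exact ⟨Fintype.card σ,
      LRNN.exists_isGHNetwork_recognizes henc (⟨M.start, M.step⟩ : FSA α σ) M.accept⟩
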